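/- For $a,b\in\{0,1\}$ and positive integers $j,l$, where $j\ge 2$ or $a=1$, let $$L(j,l;a,b)=\sum_{m>n>0}\frac{(-1)^{am+bn}}{m^{j}n^{l}}=\lim_{M\to\infty}\ \sum_{M\ge m>n>0}\frac{(-1)^{am+bn}}{m^{j}n^{l}},$$ and write this alternating double zeta value as $\zeta(j,l)=L(j,l;0,0)$, $\zeta^{(2)}(j,\overline{l})=L(j,l;0,1)$, $\zeta^{(2)}(\overline{j},l)=L(j,l;1,0)$, $\zeta^{(2)}(\overline{j},\overline{l})=L(j,l;1,1)$. Let also $\zeta(k)=\sum_{m\ge1}m^{-k}$ and $\zeta^{(2)}(\overline{k})=\sum_{m\ge1}(-1)^m m^{-k}$. Then for every integer $k\ge 3$ all the series occurring below converge, and \begin{align*} &\sum_{j=2}^{k-1}\zeta(j,k-j)=\zeta(k),\\ &\sum_{j=2}^{k-1}\zeta^{(2)}(j,\overline{k-j})=\zeta^{(2)}(\overline{k-1},1)-\zeta^{(2)}(\overline{k-1},\overline{1})+\zeta^{(2)}(\overline{k}),\\ &\sum_{j=1}^{k-1}\zeta^{(2)}(\overline{j},\overline{k-j})=\zeta^{(2)}(\overline{1},k-1)+\zeta^{(2)}(\overline{k}),\\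 &\sum_{j=1}^{k-1}\zeta^{(2)}(\overline{j},k-j)=\zeta^{(2)}(\overline{k-1},\overline{1})-\zeta^{(2)}(\overline{k-1},1)+\zeta^{(2)}(\overline{1},\overline{k-1})+\zeta(k). \end{align*} -/

import Mathlib

open Filter Topology

noncomputable section

/-- The partial sum `∑_{M ≥ m > 0} (-1)^{a m} / m^k`. -/
def altZetaPartial (k : ℕ) (a : ZMod 2) (M : ℕ) : ℝ :=
  ∑ m ∈ Finset.Icc 1 M, (-1 : ℝ) ^ (a.val * m) / (m : ℝ) ^ k

/-- The alternating zeta value of depth one: `ζ^{(2)}(k)` for `a = 0` and `ζ^{(2)}(k̄)` for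
`a = 1`, that is `∑_{m > 0} (-1)^{a m} / m^k`, summed in increasing order of `m`. -/
def altZeta (k : ℕ) (a : ZMod 2) : ℝ :=
  limUnder atTop (altZetaPartial k a)

/-- The partial sum `∑_{M ≥ m > n > 0} (-1)^{a m + b n} / (m^k n^l)`. -/
def altDoubleZetaPartial (k l : ℕ) (a b : ZMod 2) (M : ℕ) : ℝ :=
  ∑ m ∈ Finset.Icc 1 M, ∑ n ∈ Finset.Ico 1 m,
    (-1 : ℝ) ^ (a.val * m + b.val * n) / ((m : ℝ) ^ k * (n : ℝ) ^ l)

/-- The alternating double zeta value `∑_{m > n > 0} (-1)^{a m + b n} / (m^k n^l)`, summed in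
increasing order of the outer index `m` (for `k = 1` the series converges only conditionally).
The first argument `k` is barred iff `a = 1`, the second argument `l` is barred iff `b = 1`. -/
def altDoubleZeta (k l : ℕ) (a b : ZMod 2) : ℝ :=
  limUnder atTop (altDoubleZetaPartial k l a b)

end

/-! Put k = r + 1. For fixed m > n the sum over j of m^{-j} n^{-(k-j)} is geometric and equals
(n^{-r} - m^{-r})/(m - n). In the m^{-r} part, n ↦ m - n gives a double zeta sum with second
exponent 1. In the n^{-r} part, p = m - n gives a sum over n + p ≤ M, which is the product of the
truncated ζ(r) and ζ(1) sums up to a corner term; the quasi-shuffle product expands that product.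
This yields one exact identity for every cutoff M and all signs (`sum_altDoubleZetaPartial`). The
corner term tends to 0, and for a = 0 the divergent j = 1 terms cancel before the limit is taken. -/

/-- The sign character `m ↦ (-1)^{a m}`. -/
def altSign (a : ZMod 2) (m : ℕ) : ℝ := (-1 : ℝ) ^ (a.val * m)

theorem abs_altSign (a : ZMod 2) (m : ℕ) : |altSign a m| = 1 := by
  simp [altSign, abs_pow]

theorem altSign_add_right (a : ZMod 2) (m n : ℕ) :
    altSign a (m + n) = altSign a m * altSign a n := by
  simp only [altSign, mul_add, pow_add]

theorem altSign_add_left (a b : ZMod 2) (m : ℕ) :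
    altSign (a + b) m = altSign a m * altSign b m := by
  simp only [altSign, pow_mul, ← mul_pow]
  congr 1
  have h2 : ZMod.val (2 : ZMod 2) = 0 := by decide
  have h01 : ∀ c : ZMod 2, c = 0 ∨ c = 1 := by decide
  rcases h01 a with rfl | rfl <;> rcases h01 b with rfl | rfl <;>
    norm_num [ZMod.val_one, h2]

theorem altSign_mul_self (a : ZMod 2) (m : ℕ) : altSign a m * altSign a m = 1 := by
  rw [← abs_mul_abs_self, abs_altSign, one_mul]

theorem altZetaPartial_eq (k : ℕ) (a : ZMod 2) (M : ℕ) :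
    altZetaPartial k a M = ∑ m ∈ Finset.Icc 1 M, altSign a m / (m : ℝ) ^ k := rfl

theorem altDoubleZetaPartial_eq (k l : ℕ) (a b : ZMod 2) (M : ℕ) :
    altDoubleZetaPartial k l a b M =
      ∑ m ∈ Finset.Icc 1 M, ∑ n ∈ Finset.Ico 1 m,
        altSign a m / (m : ℝ) ^ k * (altSign b n / (n : ℝ) ^ l) := by
  simp only [altDoubleZetaPartial, altSign, pow_add, div_mul_div_comm]

/-! ### Exact identities at finite cutoff -/

/-- The quasi-shuffle product of two truncated series. -/
theorem sum_Icc_mul_sum_Icc (f g : ℕ → ℝ) (M : ℕ) :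
    (∑ m ∈ Finset.Icc 1 M, f m) * ∑ m ∈ Finset.Icc 1 M, g m =
      ∑ m ∈ Finset.Icc 1 M, ∑ n ∈ Finset.Ico 1 m, f m * g n +
      ∑ m ∈ Finset.Icc 1 M, ∑ n ∈ Finset.Ico 1 m, g m * f n +
      ∑ m ∈ Finset.Icc 1 M, f m * g m := by
  induction M with
  | zero => simp
  | succ M ih =>
    have hI : Finset.Ico 1 (M + 1) = Finset.Icc 1 M := by ext; simp
    simp only [Finset.sum_Icc_succ_top (Nat.le_add_left 1 M), hI, ← Finset.mul_sum]
    simp only [← Finset.mul_sum] at ih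
    linear_combination ih

theorem altZetaPartial_mul (k l : ℕ) (a b : ZMod 2) (M : ℕ) :
    altZetaPartial k a M * altZetaPartial l b M =
      altDoubleZetaPartial k l a b M + altDoubleZetaPartial l k b a M +
        altZetaPartial (k + l) (a + b) M := by
  simp only [altZetaPartial_eq, altDoubleZetaPartial_eq, sum_Icc_mul_sum_Icc, altSign_add_left,
    div_mul_div_comm, pow_add]

/-- Geometric summation of `m^{-j} n^{-(k-j)}` over `1 ≤ j ≤ k - 1`, with `k = r + 1`. -/
theorem sum_inv_pow_mul_inv_pow {x y : ℝ} (hx : x ≠ 0) (hy : y ≠ 0) (hxy : x - y ≠ 0) (r : ℕ) :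
    ∑ j ∈ Finset.Icc 1 r, 1 / (x ^ j * y ^ (r + 1 - j)) =
      (1 / y ^ r - 1 / x ^ r) / (x - y) := by
  induction r with
  | zero => simp
  | succ r ih =>
    have : ∀ j ∈ Finset.Icc 1 r, 1 / (x ^ j * y ^ (r + 1 + 1 - j)) =
        1 / (x ^ j * y ^ (r + 1 - j)) * (1 / y) := by
      intro j hj
      rw [Finset.mem_Icc] at hj
      rw [show r + 1 + 1 - j = (r + 1 - j) + 1 by omega, pow_succ]
      field_simp
    rw [Finset.sum_Icc_succ_top (Nat.le_add_left 1 r), Finset.sum_congr rfl this,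
      ← Finset.sum_mul, ih, show r + 1 + 1 - (r + 1) = 1 by omega]
    field_simp
    ring

/-- Reflecting n ↦ m - n keeps the cutoff on m, so no error arises; b moves onto m because n = m -
(m - n). -/
theorem sum_shifted_quotient (r : ℕ) (a b : ZMod 2) (M : ℕ) :
    ∑ m ∈ Finset.Icc 1 M, ∑ n ∈ Finset.Ico 1 m,
      altSign a m * altSign b n * (1 / (m : ℝ) ^ r / ((m : ℝ) - n)) =
      altDoubleZetaPartial r 1 (a + b) b M := by
  rw [altDoubleZetaPartial_eq]
  refine Finset.sum_congr rfl fun m _ => ?_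
  refine Finset.sum_nbij' (fun n => m - n) (fun n => m - n) ?_ ?_ ?_ ?_ ?_
  · intro n hn; simp only [Finset.mem_Ico] at *; omega
  · intro n hn; simp only [Finset.mem_Ico] at *; omega
  · intro n hn; simp only [Finset.mem_Ico] at *; omega
  · intro n hn; simp only [Finset.mem_Ico] at *; omega
  · intro n hn
    simp only [Finset.mem_Ico] at hn
    have h := altSign_add_right b (m - n) n
    rw [Nat.sub_add_cancel hn.2.le] at h
    rw [altSign_add_left, h, Nat.cast_sub hn.2.le, pow_one]
    linear_combination (-altSign a m * altSign b n * (1 / (m : ℝ) ^ r / ((m : ℝ) - n))) *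
      altSign_mul_self b (m - n)

theorem sum_shifted_quotient_swap (r : ℕ) (a b : ZMod 2) (M : ℕ) :
    ∑ m ∈ Finset.Icc 1 M, ∑ n ∈ Finset.Ico 1 m,
      altSign a m * altSign b n * (1 / (n : ℝ) ^ r / ((m : ℝ) - n)) =
      ∑ n ∈ Finset.Icc 1 M, altSign (a + b) n / (n : ℝ) ^ r * altZetaPartial 1 a (M - n) := by
  induction M with
  | zero => simp
  | succ M ih =>
    have hI : Finset.Ico 1 (M + 1) = Finset.Icc 1 M := by ext; simp
    have hz : altZetaPartial 1 a 0 = 0 := by simp [altZetaPartial]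
    -- The new summand n = M + 1 carries an empty inner sum; each other n gains one term p = M + 1 -
    -- n.
    rw [Finset.sum_Icc_succ_top (Nat.le_add_left 1 M), ih,
      Finset.sum_Icc_succ_top (Nat.le_add_left 1 M), hI, Nat.sub_self, hz, mul_zero, add_zero,
      ← Finset.sum_add_distrib]
    refine Finset.sum_congr rfl fun n hn => ?_
    rw [Finset.mem_Icc] at hn
    have h := altSign_add_right a (M + 1 - n) n
    rw [Nat.sub_add_cancel (by omega)] at h
    have hc : ((M + 1 - n : ℕ) : ℝ) = ((M + 1 : ℕ) : ℝ) - n := Nat.cast_sub (by omega)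
    rw [altSign_add_left, h, ← hc, show M + 1 - n = (M - n) + 1 by omega, altZetaPartial_eq,
      altZetaPartial_eq, Finset.sum_Icc_succ_top (Nat.le_add_left 1 _), pow_one]
    ring

/-- The truncation error in the sum formula. -/
noncomputable def truncationError (r : ℕ) (a b : ZMod 2) (M : ℕ) : ℝ :=
  ∑ n ∈ Finset.Icc 1 M, altSign (a + b) n / (n : ℝ) ^ r *
    (altZetaPartial 1 a M - altZetaPartial 1 a (M - n))

theorem sum_altDoubleZetaPartial (r : ℕ) (a b : ZMod 2) (M : ℕ) :
    ∑ j ∈ Finset.Icc 1 r, altDoubleZetaPartial j (r + 1 - j) a b M =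
      altDoubleZetaPartial r 1 (a + b) a M + altDoubleZetaPartial 1 r a (a + b) M +
        altZetaPartial (r + 1) b M - altDoubleZetaPartial r 1 (a + b) b M -
        truncationError r a b M := by
  have hgeom : ∑ j ∈ Finset.Icc 1 r, altDoubleZetaPartial j (r + 1 - j) a b M =
      ∑ n ∈ Finset.Icc 1 M, altSign (a + b) n / (n : ℝ) ^ r * altZetaPartial 1 a (M - n) -
        altDoubleZetaPartial r 1 (a + b) b M := by
    rw [← sum_shifted_quotient, ← sum_shifted_quotient_swap, ← Finset.sum_sub_distrib]
    simp only [altDoubleZetaPartial_eq]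
    rw [Finset.sum_comm]
    refine Finset.sum_congr rfl fun m _ => ?_
    rw [Finset.sum_comm, ← Finset.sum_sub_distrib]
    refine Finset.sum_congr rfl fun n hn => ?_
    rw [Finset.mem_Ico] at hn
    have hn0 : (n : ℝ) ≠ 0 := by exact_mod_cast (by omega : n ≠ 0)
    have hm0 : (m : ℝ) ≠ 0 := by exact_mod_cast (by omega : m ≠ 0)
    have hmn : (m : ℝ) - n ≠ 0 := sub_ne_zero.2 (by exact_mod_cast hn.2.ne')
    rw [← mul_sub, ← sub_div, ← sum_inv_pow_mul_inv_pow hm0 hn0 hmn, Finset.mul_sum]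
    refine Finset.sum_congr rfl fun j _ => ?_
    rw [div_mul_div_comm, mul_one_div]
  have hst := altZetaPartial_mul r 1 (a + b) a M
  rw [show a + b + a = b by rw [add_comm a b, add_assoc, CharTwo.add_self_eq_zero, add_zero]]
    at hst
  have herr : truncationError r a b M =
      altZetaPartial r (a + b) M * altZetaPartial 1 a M -
      ∑ n ∈ Finset.Icc 1 M, altSign (a + b) n / (n : ℝ) ^ r * altZetaPartial 1 a (M - n) := by
    rw [truncationError, altZetaPartial_eq r, Finset.sum_mul, ← Finset.sum_sub_distrib]
    simp only [mul_sub]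
  linear_combination hgeom + hst + herr

/-! ### The truncation error vanishes in the limit -/

theorem abs_altZetaPartial_one_sub_le (a : ZMod 2) {M n : ℕ} (hn : n ≤ M) :
    |altZetaPartial 1 a M - altZetaPartial 1 a (M - n)| ≤ n / ((M : ℝ) + 1 - n) := by
  have hsplit : altZetaPartial 1 a M - altZetaPartial 1 a (M - n) =
      ∑ m ∈ Finset.Ioc (M - n) M, altSign a m / (m : ℝ) ^ 1 := by
    rw [altZetaPartial_eq, altZetaPartial_eq, sub_eq_iff_eq_add', ← Finset.sum_union]
    · congr 1; ext; simp; omega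
    · rw [Finset.disjoint_left]; intro x; simp; omega
  have hM : (n : ℝ) ≤ M := by exact_mod_cast hn
  have hpos : (0 : ℝ) < (M : ℝ) + 1 - n := by linarith
  rw [hsplit]
  refine (Finset.abs_sum_le_sum_abs _ _).trans ?_
  refine (Finset.sum_le_card_nsmul _ _ (1 / ((M : ℝ) + 1 - n)) fun m hm => ?_).trans ?_
  · rw [Finset.mem_Ioc] at hm
    have : ((M + 1 : ℕ) : ℝ) ≤ ((m + n : ℕ) : ℝ) := by exact_mod_cast (by omega)
    push_cast at this
    rw [pow_one, abs_div, abs_altSign, Nat.abs_cast]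
    exact one_div_le_one_div_of_le hpos (by linarith)
  · rw [Nat.card_Ioc, Nat.sub_sub_self hn, nsmul_eq_mul, mul_one_div]

/-- A crude substitute for the logarithmic bound; any o(M) bound would do for the error term, and √M
also leaves a convergent exponent 3/2 in the double series. -/
theorem sum_one_div_le_two_mul_sqrt (M : ℕ) :
    ∑ n ∈ Finset.Icc 1 M, 1 / (n : ℝ) ≤ 2 * √(M : ℝ) := by
  induction M with
  | zero => simp
  | succ M ih =>
    rw [Finset.sum_Icc_succ_top (Nat.le_add_left 1 M)]
    have h0 := Real.sqrt_nonneg (M : ℝ)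
    have h1 : 0 < √((M + 1 : ℕ) : ℝ) := Real.sqrt_pos.2 (by positivity)
    have h2 := Real.sq_sqrt (Nat.cast_nonneg (α := ℝ) M)
    have h3 := Real.sq_sqrt (Nat.cast_nonneg (α := ℝ) (M + 1))
    have key : 1 / ((M + 1 : ℕ) : ℝ) ≤ 2 * √((M + 1 : ℕ) : ℝ) - 2 * √(M : ℝ) := by
      set s := √((M + 1 : ℕ) : ℝ)
      set t := √(M : ℝ)
      push_cast at h3
      have hs1 : 1 ≤ s := by nlinarith [Nat.cast_nonneg (α := ℝ) M]
      have hts : t ≤ s := by nlinarith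
      push_cast
      rw [← h3, div_le_iff₀ (by positivity)]
      have hd : (s - t) * (s + t) = 1 := by nlinarith
      nlinarith [mul_nonneg (sub_nonneg.2 hts) (sub_nonneg.2 hts),
        mul_le_mul_of_nonneg_left (by nlinarith : s + t ≤ 2 * s ^ 2) (sub_nonneg.2 hts)]
    linarith

theorem abs_truncationError_le {r : ℕ} (hr : 2 ≤ r) (a b : ZMod 2) (M : ℕ) :
    |truncationError r a b M| ≤ 4 * (√(M : ℝ) / ((M : ℝ) + 1)) := by
  have hM : (0 : ℝ) < (M : ℝ) + 1 := by positivity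
  have hterm : ∀ n ∈ Finset.Icc 1 M,
      |altSign (a + b) n / (n : ℝ) ^ r *
        (altZetaPartial 1 a M - altZetaPartial 1 a (M - n))| ≤
      (1 / (n : ℝ) + 1 / ((M + 1 - n : ℕ) : ℝ)) / ((M : ℝ) + 1) := by
    intro n hn
    rw [Finset.mem_Icc] at hn
    have hn1 : (1 : ℝ) ≤ n := by exact_mod_cast hn.1
    have hnM : (n : ℝ) ≤ M := by exact_mod_cast hn.2
    have hpos : (0 : ℝ) < (M : ℝ) + 1 - n := by linarith
    rw [abs_mul, abs_div, abs_altSign, abs_of_nonneg (by positivity : (0 : ℝ) ≤ (n : ℝ) ^ r),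
      Nat.cast_sub (by omega), Nat.cast_add, Nat.cast_one]
    calc 1 / (n : ℝ) ^ r * |altZetaPartial 1 a M - altZetaPartial 1 a (M - n)|
        ≤ 1 / (n : ℝ) ^ 2 * (n / ((M : ℝ) + 1 - n)) := by
          gcongr ?_ * ?_
          · exact one_div_le_one_div_of_le (by positivity) (pow_le_pow_right₀ hn1 hr)
          · exact abs_altZetaPartial_one_sub_le a hn.2
      -- Partial fractions of 1/(n(M + 1 - n)); both halves sum to the same harmonic number.
      _ = _ := by
          field_simp
          ring
  refine (Finset.abs_sum_le_sum_abs _ _).trans ((Finset.sum_le_sum hterm).trans ?_)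
  have hrefl : ∑ n ∈ Finset.Icc 1 M, 1 / ((M + 1 - n : ℕ) : ℝ) =
      ∑ n ∈ Finset.Icc 1 M, 1 / (n : ℝ) := by
    refine Finset.sum_nbij' (fun n => M + 1 - n) (fun n => M + 1 - n) ?_ ?_ ?_ ?_ ?_ <;>
      intro n hn <;> simp only [Finset.mem_Icc] at * <;> omega
  rw [← Finset.sum_div, Finset.sum_add_distrib, hrefl, ← mul_div_assoc]
  gcongr
  linarith [sum_one_div_le_two_mul_sqrt M]

theorem tendsto_truncationError {r : ℕ} (hr : 2 ≤ r) (a b : ZMod 2) :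
    Tendsto (truncationError r a b) atTop (𝓝 0) := by
  refine squeeze_zero_norm (a := fun M : ℕ => 4 * (√(M : ℝ))⁻¹) (fun M => ?_) ?_
  · rw [Real.norm_eq_abs]
    refine (abs_truncationError_le hr a b M).trans ?_
    gcongr
    rcases Nat.eq_zero_or_pos M with rfl | h
    · simp
    · have h1 : 0 < √(M : ℝ) := Real.sqrt_pos.2 (by exact_mod_cast h)
      rw [div_le_iff₀ (by positivity), inv_mul_eq_div, le_div_iff₀ h1]
      nlinarith [Real.mul_self_sqrt (Nat.cast_nonneg (α := ℝ) M)]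
  · have h := (tendsto_inv_atTop_zero.comp
      (Real.tendsto_sqrt_atTop.comp tendsto_natCast_atTop_atTop)).const_mul (4 : ℝ) (α := ℕ)
    simpa using h

/-! ### Convergence of the series -/

theorem Summable.tendsto_sum_Icc_one {f : ℕ → ℝ} (hf : Summable f) (h0 : f 0 = 0) :
    Tendsto (fun M => ∑ m ∈ Finset.Icc 1 M, f m) atTop (𝓝 (∑' m, f m)) := by
  refine ((tendsto_add_atTop_iff_nat 1).2 hf.hasSum.tendsto_sum_nat).congr fun M => ?_
  rw [Finset.sum_range_eq_add_Ico _ (Nat.succ_pos M), h0, zero_add]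
  congr 1

theorem tendsto_altZetaPartial_tsum {k : ℕ} (hk : 2 ≤ k) (a : ZMod 2) :
    Tendsto (altZetaPartial k a) atTop (𝓝 (∑' m : ℕ, altSign a m / (m : ℝ) ^ k)) := by
  refine Summable.tendsto_sum_Icc_one (f := fun m : ℕ => altSign a m / (m : ℝ) ^ k)
    (Summable.of_norm ?_) ?_
  · refine (Real.summable_one_div_nat_pow.2 (by omega : 1 < k)).congr fun m => ?_
    rw [Real.norm_eq_abs, abs_div, abs_altSign, abs_of_nonneg (by positivity)]
  · simp [show k ≠ 0 by omega]

theorem tendsto_altZetaPartial {k : ℕ} (hk : 2 ≤ k) (a : ZMod 2) :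
    Tendsto (altZetaPartial k a) atTop (𝓝 (altZeta k a)) :=
  tendsto_nhds_limUnder ⟨_, tendsto_altZetaPartial_tsum hk a⟩

theorem altZeta_zero_eq_riemannZeta {k : ℕ} (hk : 2 ≤ k) :
    ((altZeta k 0 : ℝ) : ℂ) = riemannZeta k := by
  rw [altZeta, (tendsto_altZetaPartial_tsum hk 0).limUnder_eq,
    zeta_nat_eq_tsum_of_gt_one (by omega), Complex.ofReal_tsum]
  refine tsum_congr fun m => ?_
  simp [altSign]

theorem exists_tendsto_altZetaPartial_one_one :
    ∃ l, Tendsto (altZetaPartial 1 1) atTop (𝓝 l) := by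
  have hanti : Antitone fun n : ℕ => 1 / ((n : ℝ) + 1) := fun m n h =>
    one_div_le_one_div_of_le (by positivity) (by gcongr)
  obtain ⟨l, hl⟩ := hanti.tendsto_alternating_series_of_tendsto_zero
    tendsto_one_div_add_atTop_nhds_zero_nat
  -- The alternating series test starts with sign +, whereas here m = 1 has sign -.
  refine ⟨-l, hl.neg.congr fun M => ?_⟩
  induction M with
  | zero => simp [altZetaPartial]
  | succ M ih =>
    have h1 : (1 : ZMod 2).val = 1 := by decide
    rw [Finset.sum_range_succ, neg_add, ih, altZetaPartial_eq, altZetaPartial_eq,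
      Finset.sum_Icc_succ_top (Nat.le_add_left 1 M)]
    simp only [altSign, h1, one_mul, pow_succ, pow_zero, Nat.cast_add, Nat.cast_one]
    ring

theorem exists_tendsto_altDoubleZetaPartial_of_two_le {k l : ℕ} (hk : 2 ≤ k) (hl : 1 ≤ l)
    (a b : ZMod 2) : ∃ L, Tendsto (altDoubleZetaPartial k l a b) atTop (𝓝 L) := by
  suffices h : Summable fun m : ℕ => ∑ n ∈ Finset.Ico 1 m,
      altSign a m / (m : ℝ) ^ k * (altSign b n / (n : ℝ) ^ l) from
    ⟨_, (h.tendsto_sum_Icc_one (by simp)).congr fun M => (altDoubleZetaPartial_eq k l a b M).symm⟩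
  refine Summable.of_norm_bounded
    ((Real.summable_one_div_nat_rpow.2 (by norm_num : (1 : ℝ) < 3 / 2)).mul_left 2) fun m => ?_
  rcases Nat.eq_zero_or_pos m with rfl | hm
  · simp
  have hm1 : (1 : ℝ) ≤ m := by exact_mod_cast hm
  rw [← Finset.mul_sum, Real.norm_eq_abs, abs_mul, abs_div, abs_altSign,
    abs_of_nonneg (by positivity : (0 : ℝ) ≤ (m : ℝ) ^ k)]
  have hinner : |∑ n ∈ Finset.Ico 1 m, altSign b n / (n : ℝ) ^ l| ≤ 2 * √(m : ℝ) := by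
    refine (Finset.abs_sum_le_sum_abs _ _).trans (le_trans ?_ (sum_one_div_le_two_mul_sqrt m))
    refine (Finset.sum_le_sum fun n hn => ?_).trans
      (Finset.sum_le_sum_of_subset_of_nonneg Finset.Ico_subset_Icc_self
        fun n _ _ => by positivity)
    rw [Finset.mem_Ico] at hn
    have hn1 : (1 : ℝ) ≤ n := by exact_mod_cast hn.1
    rw [abs_div, abs_altSign, abs_of_nonneg (by positivity : (0 : ℝ) ≤ (n : ℝ) ^ l)]
    exact one_div_le_one_div_of_le (by linarith) (le_self_pow₀ hn1 (by omega))
  calc 1 / (m : ℝ) ^ k * |∑ n ∈ Finset.Ico 1 m, altSign b n / (n : ℝ) ^ l|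
      ≤ 1 / (m : ℝ) ^ 2 * (2 * √(m : ℝ)) := by gcongr
    _ = 2 * (1 / (m : ℝ) ^ (3 / 2 : ℝ)) := by
      have h : (m : ℝ) ^ 2 = (m : ℝ) ^ (3 / 2 : ℝ) * √(m : ℝ) := by
        rw [Real.sqrt_eq_rpow, ← Real.rpow_add (by linarith), ← Real.rpow_natCast]
        norm_num
      have h1 : √(m : ℝ) ≠ 0 := (Real.sqrt_pos.2 (by linarith)).ne'
      have h2 : (m : ℝ) ^ (3 / 2 : ℝ) ≠ 0 := (Real.rpow_pos_of_pos (by linarith) _).ne'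
      rw [h]
      field_simp

/-- The quasi-shuffle product writes this conditionally convergent sum through sums already known to
converge. -/
theorem exists_tendsto_altDoubleZetaPartial_one {l : ℕ} (hl : 2 ≤ l) (b : ZMod 2) :
    ∃ L, Tendsto (altDoubleZetaPartial 1 l 1 b) atTop (𝓝 L) := by
  obtain ⟨A, hA⟩ := exists_tendsto_altZetaPartial_one_one
  obtain ⟨D, hD⟩ := exists_tendsto_altDoubleZetaPartial_of_two_le hl le_rfl b 1
  refine ⟨_, (((hA.mul (tendsto_altZetaPartial hl b)).sub hD).sub
    (tendsto_altZetaPartial (by omega : 2 ≤ 1 + l) (1 + b))).congr fun M => ?_⟩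
  linear_combination altZetaPartial_mul 1 l 1 b M

theorem tendsto_altDoubleZetaPartial {j l : ℕ} (hl : 1 ≤ l) (hjl : 3 ≤ j + l) {a : ZMod 2}
    (b : ZMod 2) (hj : 1 ≤ j) (h : 2 ≤ j ∨ a = 1) :
    Tendsto (altDoubleZetaPartial j l a b) atTop (𝓝 (altDoubleZeta j l a b)) := by
  refine tendsto_nhds_limUnder ?_
  by_cases hj2 : 2 ≤ j
  · exact exists_tendsto_altDoubleZetaPartial_of_two_le hj2 hl a b
  · obtain rfl : a = 1 := h.resolve_left hj2
    obtain rfl : j = 1 := by omega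
    exact exists_tendsto_altDoubleZetaPartial_one (by omega) b

/-! ### Passage to the limit -/

/-- The sum formula when the outer sign character is trivial. -/
theorem sum_altDoubleZeta_zero {r : ℕ} (hr : 2 ≤ r) (b : ZMod 2) :
    ∑ j ∈ Finset.Icc 2 r, altDoubleZeta j (r + 1 - j) 0 b =
      altDoubleZeta r 1 b 0 - altDoubleZeta r 1 b b + altZeta (r + 1) b := by
  have hL : Tendsto (fun M => ∑ j ∈ Finset.Icc 2 r, altDoubleZetaPartial j (r + 1 - j) 0 b M)
      atTop (𝓝 (∑ j ∈ Finset.Icc 2 r, altDoubleZeta j (r + 1 - j) 0 b)) := by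
    refine tendsto_finsetSum _ fun j hj => ?_
    rw [Finset.mem_Icc] at hj
    exact tendsto_altDoubleZetaPartial (by omega) (by omega) b (by omega) (Or.inl hj.1)
  have hR := (((tendsto_altDoubleZetaPartial le_rfl (by omega) 0 (by omega)
    (Or.inl hr) : Tendsto (altDoubleZetaPartial r 1 b 0) _ _).sub
    (tendsto_altDoubleZetaPartial le_rfl (by omega) b (by omega)
    (Or.inl hr) : Tendsto (altDoubleZetaPartial r 1 b b) _ _)).add
    (tendsto_altZetaPartial (by omega : 2 ≤ r + 1) b)).sub (tendsto_truncationError hr 0 b)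
  rw [sub_zero] at hR
  refine tendsto_nhds_unique hL (hR.congr fun M => ?_)
  have h := sum_altDoubleZetaPartial r 0 b M
  -- Isolate j = 1: for a = 0 it equals the term `altDoubleZetaPartial 1 r 0 b M` on the right and
  -- cancels.
  rw [← Finset.add_sum_Ioc_eq_sum_Icc (by omega : 1 ≤ r), zero_add, Nat.add_sub_cancel] at h
  rw [show Finset.Icc 2 r = Finset.Ioc 1 r from rfl]
  linear_combination -h

/-- The sum formula when the outer sign character is nontrivial. -/
theorem sum_altDoubleZeta_one {r : ℕ} (hr : 2 ≤ r) (b : ZMod 2) :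
    ∑ j ∈ Finset.Icc 1 r, altDoubleZeta j (r + 1 - j) 1 b =
      altDoubleZeta r 1 (1 + b) 1 - altDoubleZeta r 1 (1 + b) b +
        altDoubleZeta 1 r 1 (1 + b) + altZeta (r + 1) b := by
  have hL : Tendsto (fun M => ∑ j ∈ Finset.Icc 1 r, altDoubleZetaPartial j (r + 1 - j) 1 b M)
      atTop (𝓝 (∑ j ∈ Finset.Icc 1 r, altDoubleZeta j (r + 1 - j) 1 b)) := by
    refine tendsto_finsetSum _ fun j hj => ?_
    rw [Finset.mem_Icc] at hj
    exact tendsto_altDoubleZetaPartial (by omega) (by omega) b (by omega) (Or.inr rfl)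
  have hR := ((((tendsto_altDoubleZetaPartial le_rfl (by omega) 1 (by omega)
    (Or.inl hr) : Tendsto (altDoubleZetaPartial r 1 (1 + b) 1) _ _).sub
    (tendsto_altDoubleZetaPartial le_rfl (by omega) b (by omega)
    (Or.inl hr) : Tendsto (altDoubleZetaPartial r 1 (1 + b) b) _ _)).add
    (tendsto_altDoubleZetaPartial (by omega : 1 ≤ r) (by omega) (1 + b) le_rfl (Or.inr rfl))).add
    (tendsto_altZetaPartial (by omega : 2 ≤ r + 1) b)).sub (tendsto_truncationError hr 1 b)
  rw [sub_zero] at hR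
  refine tendsto_nhds_unique hL (hR.congr fun M => ?_)
  linear_combination -sum_altDoubleZetaPartial r 1 b M

theorem mainTheorem6 (k : ℕ) (hk : 3 ≤ k) :
    -- the series defining the values of weight `k` converge
    (∀ a : ZMod 2, Tendsto (altZetaPartial k a) atTop (𝓝 (altZeta k a))) ∧
    (∀ j ∈ Finset.Icc 1 (k - 1), ∀ a b : ZMod 2, (2 ≤ j ∨ a = 1) →
      Tendsto (altDoubleZetaPartial j (k - j) a b) atTop
        (𝓝 (altDoubleZeta j (k - j) a b))) ∧
    -- the four sum formulas
    ((∑ j ∈ Finset.Icc 2 (k - 1), altDoubleZeta j (k - j) 0 0 : ℝ) : ℂ) = riemannZeta k ∧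
    ∑ j ∈ Finset.Icc 2 (k - 1), altDoubleZeta j (k - j) 0 1 =
      altDoubleZeta (k - 1) 1 1 0 - altDoubleZeta (k - 1) 1 1 1 + altZeta k 1 ∧
    ∑ j ∈ Finset.Icc 1 (k - 1), altDoubleZeta j (k - j) 1 1 =
      altDoubleZeta 1 (k - 1) 1 0 + altZeta k 1 ∧
    ((∑ j ∈ Finset.Icc 1 (k - 1), altDoubleZeta j (k - j) 1 0 : ℝ) : ℂ) =
      ((altDoubleZeta (k - 1) 1 1 1 - altDoubleZeta (k - 1) 1 1 0
        + altDoubleZeta 1 (k - 1) 1 1 : ℝ) : ℂ) + riemannZeta k := by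
  obtain ⟨r, rfl⟩ : ∃ r, k = r + 1 := ⟨k - 1, by omega⟩
  have hr : 2 ≤ r := by omega
  have h11 : (1 : ZMod 2) + 1 = 0 := by decide
  simp only [Nat.add_sub_cancel]
  refine ⟨tendsto_altZetaPartial (by omega), fun j hj a b h => ?_, ?_, ?_, ?_, ?_⟩
  · rw [Finset.mem_Icc] at hj
    exact tendsto_altDoubleZetaPartial (by omega) (by omega) b hj.1 h
  · rw [sum_altDoubleZeta_zero hr, sub_self, zero_add, altZeta_zero_eq_riemannZeta (by omega)]
  · exact sum_altDoubleZeta_zero hr 1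
  · rw [sum_altDoubleZeta_one hr, h11, sub_self, zero_add]
  · rw [sum_altDoubleZeta_one hr, add_zero, Complex.ofReal_add,
      altZeta_zero_eq_riemannZeta (by omega)]
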